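/- Let $X$ be a compact Abelian topological group that is topologically isomorphic to a product $\prod_{p>2} X_p$ (with the product topology) over all primes $p>2$, where each $X_p$ is a finite Abelian $p$-group (possibly trivial) with the discrete topology. Let $K$ be a compact subgroup of $X$, let $m_K$ be the Haar distribution of $K$, i.e. the normalized Haar measure of $K$ regarded as a Borel probability measure on $X$, and let $\alpha$ be a topological automorphism of $X$ such that $\mathrm{Ker}(I+\alpha)=\{0\}$, where $I$ is the identity automorphism of $X$. Let $\xi_1$ and $\xi_2$ be independent random variables with values in $X$, each with distribution $m_K$. Then the following assertions are equivalent: (i) the conditional distribution of the linear form $L_2=\xi_1+\alpha\xi_2$ given $L_1=\xi_1+\xi_2$ is symmetric, i.e. for almost every $x$ with respect to the distribution of $L_1$, the conditional distribution of $L_2$ given $L_1=x$ is invariant under $y\mapsto -y$; (ii) $(I-\alpha)(K)=K$. -/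

import Mathlib

open MeasureTheory ProbabilityTheory

/-- A compact Hausdorff second countable space is Polish (hence a standard Borel space). -/
instance polishSpace_of_compact_secondCountable {X : Type*} [TopologicalSpace X] [CompactSpace X]
    [T2Space X] [SecondCountableTopology X] : PolishSpace X := by
  let _ := TopologicalSpace.metrizableSpaceMetric X
  infer_instance

/-- The Haar distribution `m_K` of a compact subgroup `K` of `X`: the Haar measure of `K` of total
mass one, regarded as a Borel measure on `X`. -/
noncomputable def haarDistribution {X : Type*} [AddCommGroup X] [TopologicalSpace X]
    [IsTopologicalAddGroup X] [MeasurableSpace X] [BorelSpace X]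
    (K : AddSubgroup X) [CompactSpace K] : Measure X :=
  (Measure.addHaarMeasure (⊤ : TopologicalSpace.PositiveCompacts K)).map ((↑) : K → X)

/-- The conditional distribution of `η` given `ξ` is symmetric: for almost every value `x` of `ξ`,
the conditional law of `η` given `ξ = x` is invariant under `y ↦ -y`. -/
def CondDistribSymmetric {Ω X : Type*} [MeasurableSpace Ω] [AddCommGroup X] [MeasurableSpace X]
    [StandardBorelSpace X] (η ξ : Ω → X) (P : Measure Ω) [IsFiniteMeasure P] : Prop :=
  ∀ᵐ x ∂(P.map ξ), (condDistrib η ξ P x).map (fun y => -y) = condDistrib η ξ P x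

/-! Symmetry says that (L₁, -L₂) and (L₁, L₂) have the same law. Both laws are images of Haar
measure on K × K under continuous homomorphisms, so they agree exactly when the ranges do, which
amounts to 2K ≤ (I - α)(K). Since X is a product of finite groups of odd order, its subgroups nX
with n odd are arbitrarily small and of finite index. Hence 2K is dense in K, so 2K = K by
compactness, and the condition becomes K ≤ (I - α)(K). Modulo each nX a counting argument turns this
inclusion into equality, and closedness of K lifts it to X. -/

/-- Two continuous homomorphisms on a compact group push the normalized Haar measure forward to the
same measure if and only if they have the same range. -/
theorem map_haar_eq_map_haar_iff_range_eq {G Y : Type*}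
    [AddCommGroup G] [TopologicalSpace G] [IsTopologicalAddGroup G] [CompactSpace G]
    [MeasurableSpace G] [BorelSpace G]
    [AddCommGroup Y] [TopologicalSpace Y] [IsTopologicalAddGroup Y] [T2Space Y]
    [MeasurableSpace Y] [BorelSpace Y]
    (μ : Measure G) [μ.IsAddHaarMeasure] [IsProbabilityMeasure μ]
    (φ ψ : G →+ Y) (hφ : Continuous φ) (hψ : Continuous ψ) :
    μ.map φ = μ.map ψ ↔ φ.range = ψ.range := by
  have range_le : ∀ φ ψ : G →+ Y, Continuous φ → Continuous ψ → μ.map φ = μ.map ψ →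
      φ.range ≤ ψ.range := by
    intro φ ψ hφ hψ h
    have hclosed : IsClosed (ψ.range : Set Y) := by
      rw [AddMonoidHom.coe_range]
      exact (isCompact_range hψ).isClosed
    have hnull : μ (φ ⁻¹' (ψ.range : Set Y)ᶜ) = 0 := by
      rw [← Measure.map_apply hφ.measurable hclosed.measurableSet.compl, h,
        Measure.map_apply hψ.measurable hclosed.measurableSet.compl]
      convert measure_empty (μ := μ)
      ext g
      simp
    -- Haar measure charges every nonempty open set.
    have hempty := ((hclosed.isOpen_compl.preimage hφ).measure_eq_zero_iff μ).1 hnull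
    rintro _ ⟨g, rfl⟩
    by_contra hg
    exact (Set.ext_iff.1 hempty g).1 hg
  refine ⟨fun h => le_antisymm (range_le φ ψ hφ hψ h) (range_le ψ φ hψ hφ h.symm), fun h => ?_⟩
  have map_eq : ∀ χ : G →+ φ.range, Continuous χ → Function.Surjective χ →
      Measure.IsAddHaarMeasure (μ.map χ) ∧ IsProbabilityMeasure (μ.map χ) := fun χ hc hs =>
    ⟨Measure.isAddHaarMeasure_map_of_isFiniteMeasure μ χ hc hs,
      Measure.isProbabilityMeasure_map hc.measurable.aemeasurable⟩
  let φ' : G →+ φ.range := φ.rangeRestrict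
  let ψ' : G →+ φ.range := ψ.codRestrict φ.range fun g => h ▸ ⟨g, rfl⟩
  have hφ' : Continuous φ' := hφ.subtype_mk _
  have hψ' : Continuous ψ' := hψ.subtype_mk _
  have hψs : Function.Surjective ψ' := by
    rintro ⟨y, hy⟩
    obtain ⟨g, hg⟩ : y ∈ ψ.range := h ▸ hy
    exact ⟨g, Subtype.ext hg⟩
  obtain ⟨_, _⟩ := map_eq φ' hφ' φ.rangeRestrict_surjective
  obtain ⟨_, _⟩ := map_eq ψ' hψ' hψs
  have : CompactSpace φ.range := by
    refine isCompact_iff_compactSpace.1 ?_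
    rw [AddMonoidHom.coe_range]
    exact isCompact_range hφ
  have key : μ.map φ' = μ.map ψ' := Measure.isAddHaarMeasure_eq_of_isProbabilityMeasure _ _
  have := congrArg (Measure.map ((↑) : φ.range → Y)) key
  rwa [Measure.map_map measurable_subtype_coe hφ'.measurable,
    Measure.map_map measurable_subtype_coe hψ'.measurable] at this

/-- The conditional distribution of `η` given `ξ` is symmetric if and only if the pairs `(ξ, -η)`
and `(ξ, η)` have the same law. -/
theorem condDistribSymmetric_iff_map_eq {Ω X : Type*} [MeasurableSpace Ω] [AddCommGroup X]
    [MeasurableSpace X] [MeasurableNeg X] [StandardBorelSpace X] {η ξ : Ω → X} {P : Measure Ω}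
    [IsFiniteMeasure P] (hη : Measurable η) :
    CondDistribSymmetric η ξ P ↔
      P.map (fun ω => (ξ ω, -η ω)) = P.map (fun ω => (ξ ω, η ω)) := by
  have hneg : Measurable (fun y : X => -y) := measurable_neg
  have hcomp := condDistrib_comp (μ := P) (mβ := inferInstance) ξ hη.aemeasurable hneg
  have hiff := condDistrib_ae_eq_iff_measure_eq_compProd (μ := P) (mβ := inferInstance) ξ
    (hneg.comp hη).aemeasurable (condDistrib η ξ P)
  rw [compProd_map_condDistrib hη.aemeasurable] at hiff
  refine Iff.trans ⟨fun h => ?_, fun h => ?_⟩ hiff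
  · filter_upwards [hcomp, h] with x hx hx'
    rw [hx, Kernel.map_apply _ hneg, hx']
  · filter_upwards [hcomp, h] with x hx hx'
    rw [← Kernel.map_apply _ hneg, ← hx, hx']

/-- If `K ≤ f(K)` and `U` is an `f`-invariant subgroup of finite index, then `f(K) ≤ K + U`. -/
theorem AddSubgroup.map_le_sup_of_le_map {X : Type*} [AddCommGroup X] (f : X →+ X)
    (K U : AddSubgroup X) [U.FiniteIndex] (hU : U ≤ U.comap f) (hK : K ≤ K.map f) :
    K.map f ≤ K ⊔ U := by
  let q := QuotientAddGroup.mk' U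
  let g : X ⧸ U →+ X ⧸ U := QuotientAddGroup.map U U f hU
  have hgq : g.comp q = q.comp f := rfl
  have hmap : (K.map q).map g = (K.map f).map q := by
    rw [AddSubgroup.map_map, AddSubgroup.map_map, hgq]
  have hle : K.map q ≤ (K.map q).map g := hmap ▸ AddSubgroup.map_mono hK
  have heq : K.map q = (K.map q).map g := by
    -- `g` cannot enlarge the finite set `K.map q`.
    refine SetLike.coe_injective (Set.eq_of_subset_of_ncard_le hle ?_ (Set.toFinite _))
    rw [AddSubgroup.coe_map g]
    exact Set.ncard_image_le (Set.toFinite _)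
  rw [hmap] at heq
  have := AddSubgroup.map_le_iff_le_comap.1 heq.ge
  rwa [AddSubgroup.comap_map_eq, QuotientAddGroup.ker_mk'] at this

section ProductOfOddGroups

variable {X : Type*} [AddCommGroup X] [TopologicalSpace X]
  {A : {p : ℕ // p.Prime ∧ 2 < p} → Type*} [∀ p, AddCommGroup (A p)] [∀ p, Finite (A p)]
  [∀ p, TopologicalSpace (A p)]

/-- In a product of finite `p`-groups over the odd primes, every neighbourhood of zero contains a
subgroup `nX` of finite index with `n` odd. -/
theorem exists_odd_range_nsmul_subset
    (hA : ∀ p, ∀ a : A p, ∃ k : ℕ, addOrderOf a = p.1 ^ k) (e : X ≃ₜ+ (∀ p, A p))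
    {V : Set X} (hV : V ∈ nhds 0) :
    ∃ n : ℕ, Odd n ∧ (∀ x : X, n • x ∈ V) ∧ (nsmulAddMonoidHom (α := X) n).range.FiniteIndex := by
  classical
  have hcard : ∀ p, ∃ k, Nat.card (A p) = p.1 ^ k := by
    intro p
    have : Fact p.1.Prime := ⟨p.2.1⟩
    have h : IsPGroup p.1 (Multiplicative (A p)) := IsPGroup.iff_orderOf.2 (hA p)
    exact (IsPGroup.iff_card (G := Multiplicative (A p))).1 h
  have hV' : e.symm ⁻¹' V ∈ nhds (0 : ∀ p, A p) :=
    e.symm.continuous.continuousAt.preimage_mem_nhds (by simpa using hV)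
  rw [nhds_pi, Filter.mem_pi] at hV'
  obtain ⟨I, hI, t, ht, hsub⟩ := hV'
  -- `V` restricts only the coordinates in `F`. Multiplication by `n` kills these and is bijective
  -- on all others.
  let F := hI.toFinset
  let n := ∏ p ∈ F, Nat.card (A p)
  have hzero : ∀ p ∈ F, ∀ a : A p, n • a = 0 := fun p hp a =>
    addOrderOf_dvd_iff_nsmul_eq_zero.1
      ((addOrderOf_dvd_natCard a).trans (Finset.dvd_prod_of_mem _ hp))
  have hcoprime : ∀ p ∉ F, (Nat.card (A p)).Coprime n := by
    intro p hp
    refine Nat.Coprime.prod_right fun q hq => ?_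
    obtain ⟨k, hk⟩ := hcard p
    obtain ⟨l, hl⟩ := hcard q
    rw [hk, hl]
    refine Nat.Coprime.pow _ _ ((Nat.coprime_primes p.2.1 q.2.1).2 fun h => hp ?_)
    rwa [Subtype.ext h]
  refine ⟨n, ?_, fun x => ?_, ?_⟩
  · refine Finset.prod_induction _ Odd (fun _ _ => Odd.mul) odd_one fun p _ => ?_
    obtain ⟨k, hk⟩ := hcard p
    rw [hk]
    exact (p.2.1.odd_of_ne_two p.2.2.ne').pow
  · have : e (n • x) ∈ I.pi t := fun p hp => by
      rw [map_nsmul, Pi.smul_apply, hzero p (hI.mem_toFinset.2 hp)]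
      exact mem_of_mem_nhds (ht p)
    simpa using hsub this
  · let π : X →+ (∀ p : F, A p) :=
      { toFun := fun x p => e x p
        map_zero' := by ext; simp
        map_add' := by intros; ext; simp }
    have : π.ker.FiniteIndex := inferInstance
    refine AddSubgroup.finiteIndex_of_le (H := π.ker) fun x hx => ?_
    have hx' : ∀ p ∈ F, e x p = 0 := fun p hp => congrFun (AddMonoidHom.mem_ker.1 hx) ⟨p, hp⟩
    refine ⟨e.symm fun p => if hp : p ∈ F then 0 else
      (nsmulCoprime (hcoprime p hp)).symm (e x p), e.injective ?_⟩
    ext p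
    rw [nsmulAddMonoidHom_apply, map_nsmul, Pi.smul_apply, e.apply_symm_apply]
    split_ifs with hp
    · rw [smul_zero, hx' p hp]
    · exact (nsmulCoprime (hcoprime p hp)).apply_symm_apply (e x p)

variable [IsTopologicalAddGroup X] [T2Space X]

/-- Every element of a compact subgroup is twice an element of that subgroup. -/
theorem exists_two_nsmul_eq_of_mem
    (hA : ∀ p, ∀ a : A p, ∃ k : ℕ, addOrderOf a = p.1 ^ k) (e : X ≃ₜ+ (∀ p, A p))
    (K : AddSubgroup X) [CompactSpace K] {s : X} (hs : s ∈ K) : ∃ t ∈ K, 2 • t = s := by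
  have hK : IsCompact (K : Set X) := isCompact_iff_compactSpace.2 inferInstance
  have hclosed : IsClosed ((fun x : X => 2 • x) '' K) :=
    (hK.image (continuous_const_smul 2)).isClosed
  have hmem : s ∈ closure ((fun x : X => 2 • x) '' K) := by
    rw [mem_closure_iff_nhds]
    intro V hV
    have hV' : (fun x => s + x) ⁻¹' V ∈ nhds (0 : X) :=
      (continuous_const_add s).continuousAt.preimage_mem_nhds (by simpa using hV)
    obtain ⟨n, ⟨m, rfl⟩, hn, -⟩ := exists_odd_range_nsmul_subset hA e hV'
    -- With n = 2m + 1, the point 2(m + 1)s = s + ns is close to s.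
    refine ⟨_, hn s, (m + 1) • s, K.nsmul_mem hs _, ?_⟩
    change 2 • (m + 1) • s = s + (2 * m + 1) • s
    module
  rw [hclosed.closure_eq] at hmem
  exact hmem

/-- A compact subgroup contained in its image under an endomorphism equals that image. -/
theorem map_eq_of_le_map
    (hA : ∀ p, ∀ a : A p, ∃ k : ℕ, addOrderOf a = p.1 ^ k) (e : X ≃ₜ+ (∀ p, A p))
    (K : AddSubgroup X) [CompactSpace K] (f : X →+ X) (hK : K ≤ K.map f) : K.map f = K := by
  refine le_antisymm (fun y hy => ?_) hK
  have hclosed : IsClosed (K : Set X) :=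
    (isCompact_iff_compactSpace.2 inferInstance : IsCompact (K : Set X)).isClosed
  have hmem : y ∈ closure (K : Set X) := by
    rw [mem_closure_iff_nhds]
    intro V hV
    have hV' : (fun x => y - x) ⁻¹' V ∈ nhds (0 : X) :=
      (continuous_sub_left y).continuousAt.preimage_mem_nhds (by simpa using hV)
    obtain ⟨n, -, hn, _⟩ := exists_odd_range_nsmul_subset hA e hV'
    -- nX is invariant under every endomorphism.
    have hle := AddSubgroup.map_le_sup_of_le_map f K (nsmulAddMonoidHom (α := X) n).range
      (by rintro _ ⟨x, rfl⟩; exact ⟨f x, by simp⟩) hK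
    obtain ⟨k, hk, _, ⟨x, rfl⟩, rfl⟩ := AddSubgroup.mem_sup.1 (hle hy)
    exact ⟨k, by simpa using hn x, hk⟩
  rw [hclosed.closure_eq] at hmem
  exact hmem

end ProductOfOddGroups

/-- The homomorphism `(a, b) ↦ (a + b, β a + γ b)` on `K × K`. -/
def linearFormsHom {X : Type*} [AddCommGroup X] (K : AddSubgroup X) (β γ : X →+ X) :
    K × K →+ X × X :=
  (K.subtype.coprod K.subtype).prod ((β.comp K.subtype).coprod (γ.comp K.subtype))

theorem linearFormsHom_apply {X : Type*} [AddCommGroup X] (K : AddSubgroup X) (β γ : X →+ X)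
    (x : K × K) : linearFormsHom K β γ x = ((x.1 : X) + x.2, β x.1 + γ x.2) := rfl

/-- The ranges of `(a, b) ↦ (a + b, ∓(a + α b))` on `K × K` agree if and only if
`2K ≤ (I - α)(K)`. -/
theorem range_linearFormsHom_neg_eq_iff {X : Type*} [AddCommGroup X] (K : AddSubgroup X)
    (α : X →+ X) :
    (linearFormsHom K (-AddMonoidHom.id X) (-α)).range =
        (linearFormsHom K (AddMonoidHom.id X) α).range ↔
      ∀ s ∈ K, 2 • s ∈ K.map (AddMonoidHom.id X - α) := by
  constructor
  · intro h s hs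
    -- If (s, -s) = (c + d, c + αd), subtracting gives 2s = d - αd.
    have hmem : linearFormsHom K (-AddMonoidHom.id X) (-α) (⟨s, hs⟩, 0) ∈
        (linearFormsHom K (AddMonoidHom.id X) α).range := h ▸ ⟨_, rfl⟩
    obtain ⟨⟨c, d⟩, hcd⟩ := hmem
    simp only [linearFormsHom_apply, Prod.mk.injEq] at hcd
    obtain ⟨h₁, h₂⟩ := hcd
    simp at h₁ h₂
    refine ⟨d, d.2, ?_⟩
    simp only [AddMonoidHom.sub_apply, AddMonoidHom.id_apply]
    linear_combination (norm := module) h₁ - h₂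
  · intro h
    have hex : ∀ a b : K, ∃ c d : K, (c : X) + d = a + b ∧ (c : X) + α d = -a + -α b := by
      intro a b
      obtain ⟨k, hk, hk'⟩ := h (a + b) (a + b).2
      simp only [AddMonoidHom.sub_apply, AddMonoidHom.id_apply] at hk'
      -- The equations force c = a + b - d and (I - α)d = 2(a + b) - (I - α)b, which d = k - b
      -- solves.
      refine ⟨a + b - (⟨k, hk⟩ - b), ⟨k, hk⟩ - b, by simp, ?_⟩
      simp only [AddSubgroup.coe_add, AddSubgroup.coe_sub, map_sub]
      linear_combination (norm := module) -hk'
    apply le_antisymm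
    · rintro _ ⟨⟨a, b⟩, rfl⟩
      obtain ⟨c, d, h₁, h₂⟩ := hex a b
      exact ⟨(c, d), Prod.ext h₁ h₂⟩
    · rintro _ ⟨⟨a, b⟩, rfl⟩
      obtain ⟨c, d, h₁, h₂⟩ := hex a b
      refine ⟨(c, d), Prod.ext h₁ ?_⟩
      simp only [linearFormsHom_apply, AddMonoidHom.neg_apply, AddMonoidHom.id_apply]
      linear_combination (norm := module) -h₂

theorem proposition2p8
    {X : Type*} [AddCommGroup X] [TopologicalSpace X] [IsTopologicalAddGroup X]
    [CompactSpace X] [T2Space X] [SecondCountableTopology X]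
    [MeasurableSpace X] [BorelSpace X]
    {A : {p : ℕ // p.Prime ∧ 2 < p} → Type*} [∀ p, AddCommGroup (A p)] [∀ p, Finite (A p)]
    [∀ p, TopologicalSpace (A p)] [∀ p, DiscreteTopology (A p)]
    (hA : ∀ p, ∀ a : A p, ∃ k : ℕ, addOrderOf a = p.1 ^ k)
    (e : X ≃ₜ+ (∀ p, A p))
    (K : AddSubgroup X) [CompactSpace K]
    (α : X ≃ₜ+ X) (hα : (AddMonoidHom.id X + (α : X →+ X)).ker = ⊥)
    {Ω : Type*} [MeasurableSpace Ω] (P : Measure Ω) [IsProbabilityMeasure P]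
    (ξ₁ ξ₂ : Ω → X) (hξ₁ : Measurable ξ₁) (hξ₂ : Measurable ξ₂)
    (hindep : IndepFun ξ₁ ξ₂ P)
    (hlaw₁ : P.map ξ₁ = haarDistribution K) (hlaw₂ : P.map ξ₂ = haarDistribution K) :
    CondDistribSymmetric (fun ω => ξ₁ ω + α (ξ₂ ω)) (fun ω => ξ₁ ω + ξ₂ ω) P ↔
      K.map (AddMonoidHom.id X - (α : X →+ X)) = K := by
  have hαc : Continuous α := α.continuous
  have : SecondCountableTopology K :=
    TopologicalSpace.Subtype.secondCountableTopology (K : Set X)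
  let m : Measure K := Measure.addHaarMeasure ⊤
  have : IsProbabilityMeasure m := ⟨by
    simpa using Measure.addHaarMeasure_self (K₀ := (⊤ : TopologicalSpace.PositiveCompacts K))⟩
  have hpair : P.map (fun ω => (ξ₁ ω, ξ₂ ω)) =
      (m.prod m).map (Prod.map ((↑) : K → X) ((↑) : K → X)) := by
    rw [(indepFun_iff_map_prod_eq_prod_map_map hξ₁.aemeasurable hξ₂.aemeasurable).1 hindep,
      hlaw₁, hlaw₂, haarDistribution,
      Measure.map_prod_map m m measurable_subtype_coe measurable_subtype_coe]
  have hjoint : ∀ β γ : X →+ X, Continuous β → Continuous γ →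
      P.map (fun ω => (ξ₁ ω + ξ₂ ω, β (ξ₁ ω) + γ (ξ₂ ω))) =
        (m.prod m).map (linearFormsHom K β γ) := by
    intro β γ hβ hγ
    have hS : Measurable fun x : X × X => (x.1 + x.2, β x.1 + γ x.2) := by
      have : Continuous fun x : X × X => (x.1 + x.2, β x.1 + γ x.2) := by fun_prop
      exact this.measurable
    have := congrArg (Measure.map fun x : X × X => (x.1 + x.2, β x.1 + γ x.2)) hpair
    rwa [Measure.map_map hS (by fun_prop), Measure.map_map hS (by fun_prop)] at this
  have hcont : ∀ β γ : X →+ X, Continuous β → Continuous γ →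
      Continuous (linearFormsHom K β γ) := by
    intro β γ hβ hγ
    simp only [funext (linearFormsHom_apply K β γ)]
    fun_prop
  have hid : Continuous (AddMonoidHom.id X) := continuous_id
  have hα₁ : Continuous (α : X →+ X) := hαc
  have hid' : Continuous (-AddMonoidHom.id X) := hid.neg
  have hα' : Continuous (-(α : X →+ X)) := hα₁.neg
  have hneg : (fun ω => (ξ₁ ω + ξ₂ ω, -(ξ₁ ω + α (ξ₂ ω)))) =
      fun ω => (ξ₁ ω + ξ₂ ω, (-AddMonoidHom.id X) (ξ₁ ω) + (-(α : X →+ X)) (ξ₂ ω)) := by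
    ext ω
    · rfl
    · simp [add_comm]
  have hL₂ : Measurable fun ω => ξ₁ ω + α (ξ₂ ω) := hξ₁.add (hαc.measurable.comp hξ₂)
  rw [condDistribSymmetric_iff_map_eq hL₂, hneg,
    hjoint _ _ hid' hα']
  refine (Eq.congr_right (hjoint (AddMonoidHom.id X) α hid hα₁)).trans ?_
  rw [map_haar_eq_map_haar_iff_range_eq _ _ _ (hcont _ _ hid' hα') (hcont _ _ hid hα₁),
    range_linearFormsHom_neg_eq_iff]
  constructor
  · intro h
    refine map_eq_of_le_map hA e K _ fun s hs => ?_
    obtain ⟨t, ht, rfl⟩ := exists_two_nsmul_eq_of_mem hA e K hs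
    exact h t ht
  · intro h s hs
    rw [h]
    exact K.nsmul_mem hs 2
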